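/- Let $r\ge 3$ and $d\ge 1$ be integers. Let $\mathcal F_{r,2}\subset\mathbb C^{2\times r}$ be the variety of finite unit norm tight frames, that is, of all complex $2\times r$ matrices $V=(\mathbf v_1,\dots,\mathbf v_r)$ with $V V^{T}=\tfrac r2\,\mathrm{Id}_2$ and $v_{1j}^2+v_{2j}^2=1$ for $j=1,\dots,r$. Let the fradeco variety $\mathcal T_{r,2,d}\subset\mathbb P(\mathrm{Sym}_d(\mathbb C^2))=\mathbb P^d$ be the Zariski closure of the set of points $\bigl[\sum_{j=1}^r\lambda_j\,\mathbf v_j^{\otimes d}\bigr]$, where $V\in\mathcal F_{r,2}$ and $\lambda_1,\dots,\lambda_r\in\mathbb C$ are such that the sum is nonzero. Then $\mathcal T_{r,2,d}$ is irreducible and has dimension $\min(2r-3,d)$. -/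

import Mathlib

open scoped LinearAlgebra.Projectivization

/-- The complex projective space `ℙ(ℂ^σ)` with homogeneous coordinates indexed by `σ`. It is a
separate type so that its topology is the Zariski topology. -/
def ProjSpace (σ : Type) : Type := ℙ ℂ (σ → ℂ)

namespace ProjSpace

/-- The point `[x]` of projective space with homogeneous coordinates `x ≠ 0`. -/
noncomputable def mk {σ : Type} (x : σ → ℂ) (hx : x ≠ 0) : ProjSpace σ := Projectivization.mk ℂ x hx

/-- Some vector of homogeneous coordinates of a point. -/
noncomputable def coords {σ : Type} (p : ProjSpace σ) : σ → ℂ := Projectivization.rep p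

/-- The common zero locus in projective space of a set of polynomials. It is used only for sets of
homogeneous polynomials, for which it does not depend on the choice of coordinate vectors. -/
def zeroLocus {σ : Type} (S : Set (MvPolynomial σ ℂ)) : Set (ProjSpace σ) :=
  {p | ∀ F ∈ S, MvPolynomial.eval p.coords F = 0}

/-- The algebraic subsets of projective space: the zero loci of sets of homogeneous polynomials. -/
def IsAlgebraic {σ : Type} (Z : Set (ProjSpace σ)) : Prop :=
  ∃ S : Set (MvPolynomial σ ℂ), (∀ F ∈ S, ∃ k : ℕ, F.IsHomogeneous k) ∧ Z = zeroLocus S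

/-- For a homogeneous polynomial, vanishing at `[x]` is vanishing at `x`. -/
theorem eval_coords_mk {σ : Type} {F : MvPolynomial σ ℂ} {k : ℕ} (hF : F.IsHomogeneous k)
    (x : σ → ℂ) (hx : x ≠ 0) :
    MvPolynomial.eval (mk x hx).coords F = 0 ↔ MvPolynomial.eval x F = 0 := by
  obtain ⟨a, ha⟩ := Projectivization.exists_smul_eq_mk_rep ℂ x hx
  have h : (mk x hx).coords = fun i => (a : ℂ) * x i := by
    funext i
    exact (congrFun ha i).symm
  have h2 : MvPolynomial.eval (fun i => (a : ℂ) * x i) F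
      = (a : ℂ) ^ k * MvPolynomial.eval x F := by
    rw [MvPolynomial.eval_eq, MvPolynomial.eval_eq, Finset.mul_sum]
    refine Finset.sum_congr rfl fun m hm => ?_
    have hk : ∑ i ∈ m.support, m i = k := by
      have := hF (MvPolynomial.mem_support_iff.mp hm)
      rw [Finsupp.weight_apply] at this
      simpa [Finsupp.sum] using this
    simp only [mul_pow, Finset.prod_mul_distrib]
    rw [Finset.prod_pow_eq_pow_sum, hk]
    ring
  rw [h, h2]
  simp

/-- The Zariski topology on projective space: the closed sets are the algebraic sets. -/
instance zariskiTopology (σ : Type) : TopologicalSpace (ProjSpace σ) :=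
  TopologicalSpace.ofClosed {Z | IsAlgebraic Z}
    (by
      refine ⟨{1}, ?_, ?_⟩
      · rintro F rfl
        exact ⟨0, MvPolynomial.isHomogeneous_one σ ℂ⟩
      · ext p
        simp [zeroLocus])
    (by
      intro A hA
      refine ⟨{F | (∃ k : ℕ, F.IsHomogeneous k) ∧ ∃ Z ∈ A, ∀ p ∈ Z,
        MvPolynomial.eval p.coords F = 0}, fun F hF => hF.1, ?_⟩
      ext p
      constructor
      · rintro hp F ⟨_, Z, hZ, hF⟩
        exact hF p (hp Z hZ)
      · intro hp Z hZ
        obtain ⟨S, hS, rfl⟩ := hA hZ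
        exact fun F hF => hp F ⟨hS F hF, _, hZ, fun q hq => hq F hF⟩)
    (by
      rintro _ ⟨S, hS, rfl⟩ _ ⟨S', hS', rfl⟩
      refine ⟨{H | ∃ F ∈ S, ∃ G ∈ S', H = F * G}, ?_, ?_⟩
      · rintro _ ⟨F, hF, G, hG, rfl⟩
        obtain ⟨k, hk⟩ := hS F hF
        obtain ⟨l, hl⟩ := hS' G hG
        exact ⟨k + l, hk.mul hl⟩
      · ext p
        constructor
        · rintro (hp | hp) _ ⟨F, hF, G, hG, rfl⟩
          · simp [hp F hF]
          · simp [hp G hG]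
        · intro hp
          by_contra hcon
          simp only [Set.mem_union, not_or, zeroLocus, Set.mem_ofPred_eq, not_forall] at hcon
          obtain ⟨⟨F, hF, hF0⟩, G, hG, hG0⟩ := hcon
          have := hp _ ⟨F, hF, G, hG, rfl⟩
          rw [map_mul] at this
          exact (mul_ne_zero hF0 hG0) this)

theorem isClosed_iff {σ : Type} (Z : Set (ProjSpace σ)) : IsClosed Z ↔ IsAlgebraic Z := by
  rw [← isOpen_compl_iff]
  change IsAlgebraic Zᶜᶜ ↔ _
  rw [compl_compl]

end ProjSpace

/-- The variety of finite unit norm tight frames: all complex `n × r` matrices `V` with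
`V Vᵀ = (r/n) Id` whose columns `v` satisfy `∑ i, v i ^ 2 = 1`. -/
def funtfVariety (r n : ℕ) : Set (Matrix (Fin n) (Fin r) ℂ) :=
  {V | V * V.transpose = ((r : ℂ) / (n : ℂ)) • (1 : Matrix (Fin n) (Fin n) ℂ) ∧
    ∀ j : Fin r, ∑ i : Fin n, V i j ^ 2 = 1}

/-- The space of symmetric `n × ⋯ × n` tensors of order `d` over `ℂ`. A symmetric tensor is given
by its entries `t_{i₁ ⋯ i_d}`, one for each multiset `{i₁, …, i_d}` of indices. -/
abbrev SymTensor (n d : ℕ) : Type := Sym (Fin n) d → ℂ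

/-- The symmetric tensor `∑ j, lam j • v_j ^ ⊗ d`, where `v_j` is the `j`-th column of `V`; its
entry at `{i₁, …, i_d}` is `∑ j, lam j * (V i₁ j * ⋯ * V i_d j)`. -/
def waringTensor {r n : ℕ} (d : ℕ) (lam : Fin r → ℂ) (V : Matrix (Fin n) (Fin r) ℂ) :
    SymTensor n d :=
  fun s => ∑ j : Fin r, lam j * ((s : Multiset (Fin n)).map fun i => V i j).prod

/-- The fradeco variety `𝒯_{r,n,d}` in the projective space of symmetric tensors: the Zariski
closure of the set of all points `[∑ j, lam j • v_j ^ ⊗ d]` where `v_1, …, v_r` are the columns of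
a point of the funtf variety and the scalars `lam j` are arbitrary with nonzero sum tensor. -/
def fradecoVariety (r n d : ℕ) : Set (ProjSpace (Sym (Fin n) d)) :=
  closure {p | ∃ V ∈ funtfVariety r n, ∃ lam : Fin r → ℂ,
    ∃ h : waringTensor d lam V ≠ 0, p = ProjSpace.mk (waringTensor d lam V) h}

/-! In the isotropic coordinates `z = v₁ + i v₂`, `w = v₁ - i v₂`, the unit norm condition reads `z
w = 1`. With `u = z²`, a linear change of coordinates turns the tensor into the sequence `t n = ∑ j,
μ j * u j ^ n`, `0 ≤ n ≤ d`, with arbitrary `μ`. Given unit norms, tightness says `∑ u j = ∑ (u j)⁻¹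
= 0`, that is, `∏ (X - u j)` has no terms of degree `1` and `r - 1`. Hence `t` solves a linear
recurrence of order `r` whose coefficients of these two indices vanish. Conversely, such a
recurrence with simple nonzero characteristic roots comes from a frame
(`exists_funtf_of_simple_roots`), and this is the generic case. So the variety is the closure of the
image of the polynomial map `recTensor`, with `r - 2` coefficients and `r` initial values as
parameters (`fradecoVariety_eq_closure_image`), and it is irreducible.

The image is stable under scaling, so the affine cone has dimension at most `2r - 2`; this and the
ambient dimension `d` give the upper bound (`topologicalKrullDim_add_one_le`).

For the lower bound no generic rank is computed. The parameters are switched on one at a time,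
initial values first, then recurrence coefficients from the highest index down (`chainSet`). Each
inclusion of closures is strict: a coordinate `t (s + 1)` detects a new initial value, and a
Hankel-like determinant detects a new coefficient (`exists_separating_initial`,
`exists_separating_coeff`). Stage `s + 1` needs no entry beyond `t (s + 1)`, so the chain reaches
length `min (2r - 3) d`. -/

namespace ProjSpace

/-! ### Vanishing ideals of projective sets. -/

variable {σ : Type}

theorem exists_mk_eq (p : ProjSpace σ) : ∃ x, ∃ hx : x ≠ 0, mk x hx = p :=
  ⟨p.coords, Projectivization.rep_nonzero p, Projectivization.mk_rep p⟩

theorem mk_smul_eq {s : ℂ} (x : σ → ℂ) (hx : x ≠ 0) (hsx : s • x ≠ 0) :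
    mk (s • x) hsx = mk x hx :=
  (Projectivization.mk_eq_mk_iff' ℂ _ _ hsx hx).2 ⟨s, rfl⟩

theorem eval_smul_of_isHomogeneous {F : MvPolynomial σ ℂ} {k : ℕ} (hF : F.IsHomogeneous k)
    (s : ℂ) (x : σ → ℂ) : MvPolynomial.eval (s • x) F = s ^ k * MvPolynomial.eval x F := by
  rw [MvPolynomial.eval_eq, MvPolynomial.eval_eq, Finset.mul_sum]
  refine Finset.sum_congr rfl fun m hm => ?_
  have hk : ∑ i ∈ m.support, m i = k := by
    have := hF (MvPolynomial.mem_support_iff.mp hm)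
    rw [Finsupp.weight_apply] at this
    simpa [Finsupp.sum] using this
  simp only [Pi.smul_apply, smul_eq_mul, mul_pow, Finset.prod_mul_distrib]
  rw [Finset.prod_pow_eq_pow_sum, hk]
  ring

/-- The restriction of a polynomial to the line spanned by a vector. -/
noncomputable def lineRestriction (F : MvPolynomial σ ℂ) (x : σ → ℂ) : Polynomial ℂ :=
  ∑ k ∈ Finset.range (F.totalDegree + 1),
    Polynomial.C (MvPolynomial.eval x (MvPolynomial.homogeneousComponent k F)) * Polynomial.X ^ k

theorem eval_lineRestriction (F : MvPolynomial σ ℂ) (x : σ → ℂ) (s : ℂ) :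
    (lineRestriction F x).eval s = MvPolynomial.eval (s • x) F := by
  conv_rhs => rw [← MvPolynomial.sum_homogeneousComponent F]
  simp only [lineRestriction, Polynomial.eval_finsetSum, map_sum, Polynomial.eval_mul,
    Polynomial.eval_C, Polynomial.eval_pow, Polynomial.eval_X]
  refine Finset.sum_congr rfl fun k _ => ?_
  rw [eval_smul_of_isHomogeneous (MvPolynomial.homogeneousComponent_isHomogeneous k F), mul_comm]

theorem coeff_lineRestriction (F : MvPolynomial σ ℂ) (x : σ → ℂ) (k : ℕ) :
    (lineRestriction F x).coeff k
      = MvPolynomial.eval x (MvPolynomial.homogeneousComponent k F) := by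
  simp only [lineRestriction, Polynomial.finsetSum_coeff, Polynomial.coeff_C_mul_X_pow]
  rw [Finset.sum_ite_eq]
  split_ifs with h
  · rfl
  · rw [MvPolynomial.homogeneousComponent_eq_zero _ _ (by simpa using h), map_zero]

theorem lineRestriction_eq_zero_of_eval {F : MvPolynomial σ ℂ} {x : σ → ℂ}
    (h : ∀ s : ℂ, s ≠ 0 → MvPolynomial.eval (s • x) F = 0) : lineRestriction F x = 0 := by
  refine Polynomial.eq_zero_of_infinite_isRoot _ (Set.Infinite.mono (s := {0}ᶜ) ?_
    (Set.finite_singleton (0 : ℂ)).infinite_compl)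
  intro s hs
  rw [Set.mem_ofPred_eq, Polynomial.IsRoot, eval_lineRestriction]
  exact h s (by simpa using hs)

/-- The ideal of all polynomials vanishing on the affine cone (without its apex) over a set. -/
def vanishingIdeal (Z : Set (ProjSpace σ)) : Ideal (MvPolynomial σ ℂ) where
  carrier := {F | ∀ x (hx : x ≠ 0), mk x hx ∈ Z → MvPolynomial.eval x F = 0}
  add_mem' hF hG x hx h := by rw [map_add, hF x hx h, hG x hx h, add_zero]
  zero_mem' x hx h := map_zero _
  smul_mem' G F hF x hx h := by rw [smul_eq_mul, map_mul, hF x hx h, mul_zero]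

theorem vanishingIdeal_anti {Z Z' : Set (ProjSpace σ)} (h : Z ⊆ Z') :
    vanishingIdeal Z' ≤ vanishingIdeal Z :=
  fun _ hF x hx hxZ => hF x hx (h hxZ)

/-- On the line through `x`, `F` is a univariate polynomial with infinitely many zeros, and its
coefficients are the values of the homogeneous components at `x`. -/
theorem eval_homogeneousComponent_eq_zero {Z : Set (ProjSpace σ)} {F : MvPolynomial σ ℂ}
    (hF : F ∈ vanishingIdeal Z) (k : ℕ) {x : σ → ℂ} (hx : x ≠ 0) (hxZ : mk x hx ∈ Z) :
    MvPolynomial.eval x (MvPolynomial.homogeneousComponent k F) = 0 := by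
  rw [← coeff_lineRestriction, lineRestriction_eq_zero_of_eval, Polynomial.coeff_zero]
  intro s hs
  exact hF (s • x) (smul_ne_zero hs hx) (by rwa [mk_smul_eq x hx])

theorem isClosed_zeroLocus {S : Set (MvPolynomial σ ℂ)}
    (hS : ∀ F ∈ S, ∃ k : ℕ, F.IsHomogeneous k) : IsClosed (zeroLocus S) :=
  (isClosed_iff _).2 ⟨S, hS, rfl⟩

theorem mk_mem_zeroLocus {S : Set (MvPolynomial σ ℂ)}
    (hS : ∀ F ∈ S, ∃ k : ℕ, F.IsHomogeneous k) {x : σ → ℂ} (hx : x ≠ 0) :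
    mk x hx ∈ zeroLocus S ↔ ∀ F ∈ S, MvPolynomial.eval x F = 0 := by
  refine forall₂_congr fun F hF => ?_
  obtain ⟨k, hk⟩ := hS F hF
  exact eval_coords_mk hk x hx

theorem mk_mem_closure_iff {A : Set (ProjSpace σ)} {x : σ → ℂ} (hx : x ≠ 0) :
    mk x hx ∈ closure A ↔ ∀ (F : MvPolynomial σ ℂ) (k : ℕ), F.IsHomogeneous k →
      F ∈ vanishingIdeal A → MvPolynomial.eval x F = 0 := by
  constructor
  · intro h F k hF hFA
    have hS : ∀ G ∈ ({F} : Set (MvPolynomial σ ℂ)), ∃ k : ℕ, G.IsHomogeneous k := by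
      rintro G rfl
      exact ⟨k, hF⟩
    have hA : A ⊆ zeroLocus {F} := by
      intro p hp
      obtain ⟨y, hy, rfl⟩ := exists_mk_eq p
      rw [mk_mem_zeroLocus hS]
      rintro G rfl
      exact hFA y hy hp
    exact (mk_mem_zeroLocus hS hx).1 (closure_minimal hA (isClosed_zeroLocus hS) h) F rfl
  · intro h
    obtain ⟨S, hS, hSA⟩ := (isClosed_iff (closure A)).1 isClosed_closure
    rw [hSA, mk_mem_zeroLocus hS]
    intro F hF
    obtain ⟨k, hk⟩ := hS F hF
    refine h F k hk fun y hy hyA => ?_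
    have := subset_closure hyA
    rw [hSA, mk_mem_zeroLocus hS] at this
    exact this F hF

theorem vanishingIdeal_closure (A : Set (ProjSpace σ)) :
    vanishingIdeal (closure A) = vanishingIdeal A := by
  refine le_antisymm (vanishingIdeal_anti subset_closure) fun F hF x hx hxA => ?_
  rw [← MvPolynomial.sum_homogeneousComponent F, map_sum]
  refine Finset.sum_eq_zero fun k _ => ?_
  exact (mk_mem_closure_iff hx).1 hxA _ k
    (MvPolynomial.homogeneousComponent_isHomogeneous k F)
    fun y hy hyA => eval_homogeneousComponent_eq_zero hF k hy hyA

theorem subset_of_vanishingIdeal_le {Z Z' : Set (ProjSpace σ)} (hZ : IsClosed Z)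
    (h : vanishingIdeal Z ≤ vanishingIdeal Z') : Z' ⊆ Z := by
  intro p hp
  obtain ⟨x, hx, rfl⟩ := exists_mk_eq p
  rw [← hZ.closure_eq, mk_mem_closure_iff]
  exact fun F k _ hF => h hF x hx hp

/-- Only homogeneous polynomials cut out closed sets, so `F` is replaced by the set of its
components. These all vanish at `x` exactly when `lineRestriction F x = 0`, and primality then comes
from `ℂ[X]` being a domain. -/
theorem isPrime_vanishingIdeal {Z : Set (ProjSpace σ)} (hZ : IsIrreducible Z) :
    (vanishingIdeal Z).IsPrime := by
  let S (F : MvPolynomial σ ℂ) : Set (MvPolynomial σ ℂ) :=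
    Set.range fun k => MvPolynomial.homogeneousComponent k F
  have hS : ∀ F, ∀ G ∈ S F, ∃ k : ℕ, G.IsHomogeneous k := by
    rintro F _ ⟨k, rfl⟩
    exact ⟨k, MvPolynomial.homogeneousComponent_isHomogeneous k F⟩
  have hmem : ∀ F x (hx : x ≠ 0), mk x hx ∈ zeroLocus (S F) ↔ lineRestriction F x = 0 := by
    intro F x hx
    rw [mk_mem_zeroLocus (hS F), Polynomial.ext_iff]
    simp [S, coeff_lineRestriction]
  have hle : ∀ F, Z ⊆ zeroLocus (S F) → F ∈ vanishingIdeal Z := by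
    intro F hF x hx hxZ
    have := (hmem F x hx).1 (hF hxZ)
    rw [← one_smul ℂ x, ← eval_lineRestriction, this, Polynomial.eval_zero]
  refine ⟨fun htop => ?_, fun {F G} hFG => ?_⟩
  · obtain ⟨p, hp⟩ := hZ.nonempty
    obtain ⟨x, hx, rfl⟩ := exists_mk_eq p
    have h1 : (1 : MvPolynomial σ ℂ) ∈ vanishingIdeal Z := htop ▸ Submodule.mem_top
    simpa using h1 x hx hp
  · have hsub : Z ⊆ zeroLocus (S F) ∪ zeroLocus (S G) := by
      intro p hp
      obtain ⟨x, hx, rfl⟩ := exists_mk_eq p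
      rw [Set.mem_union, hmem, hmem, ← mul_eq_zero]
      refine Polynomial.eq_zero_of_infinite_isRoot _ (Set.Infinite.mono (s := {0}ᶜ) ?_
        (Set.finite_singleton (0 : ℂ)).infinite_compl)
      intro s hs
      have hs : s ≠ 0 := by simpa using hs
      rw [Set.mem_ofPred_eq, Polynomial.IsRoot, Polynomial.eval_mul, eval_lineRestriction,
        eval_lineRestriction, ← map_mul]
      exact hFG (s • x) (smul_ne_zero hs hx) (by rwa [mk_smul_eq x hx])
    rcases isPreirreducible_iff_isClosed_union_isClosed.1 hZ.isPreirreducible _ _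
      (isClosed_zeroLocus (hS F)) (isClosed_zeroLocus (hS G)) hsub with h | h
    · exact Or.inl (hle F h)
    · exact Or.inr (hle G h)

/-- The irrelevant ideal strictly contains the vanishing ideal of any nonempty set. -/
theorem vanishingIdeal_lt_ker_eval_zero {Z : Set (ProjSpace σ)} (hZ : Z.Nonempty) :
    vanishingIdeal Z < RingHom.ker (MvPolynomial.eval (0 : σ → ℂ)) := by
  obtain ⟨p, hp⟩ := hZ
  obtain ⟨x, hx, rfl⟩ := exists_mk_eq p
  obtain ⟨i, hi⟩ := Function.ne_iff.1 hx
  refine SetLike.lt_iff_le_and_exists.2 ⟨fun F hF => ?_, MvPolynomial.X i, ?_, fun h => hi ?_⟩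
  · rw [RingHom.mem_ker, ← zero_smul ℂ x, ← eval_lineRestriction,
      lineRestriction_eq_zero_of_eval, Polynomial.eval_zero]
    exact fun s hs => hF (s • x) (smul_ne_zero hs hx) (by rwa [mk_smul_eq x hx])
  · simp [RingHom.mem_ker]
  · simpa using h x hx hp

/-! ### Bounds for the dimension of a projective set. -/

/-- The dimension of a nonempty projective set is bounded by the dimension of the affine cone
over it. -/
theorem topologicalKrullDim_add_one_le {T : Set (ProjSpace σ)} (hT : IsIrreducible T)
    {A : Type*} [CommRing A] (f : MvPolynomial σ ℂ →+* A) (hf : Function.Surjective f)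
    (hker : RingHom.ker f ≤ vanishingIdeal T) :
    topologicalKrullDim T + 1 ≤ ringKrullDim A := by
  have : IrreducibleSpace T := isIrreducible_iff_irreducibleSpace.1 hT
  have : Nonempty (TopologicalSpace.IrreducibleCloseds T) :=
    ⟨⟨Set.univ, ⟨Set.univ_nonempty, PreirreducibleSpace.isPreirreducible_univ⟩, isClosed_univ⟩⟩
  let e : TopologicalSpace.IrreducibleCloseds T →
      TopologicalSpace.IrreducibleCloseds (ProjSpace σ) :=
    TopologicalSpace.IrreducibleCloseds.map Subtype.val continuous_subtype_val
  have he : StrictMono e := TopologicalSpace.IrreducibleCloseds.map_strictMono_of_isInducing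
    Topology.IsInducing.subtypeVal
  have heT : ∀ Z, RingHom.ker f ≤ vanishingIdeal (e Z : Set (ProjSpace σ)) := by
    intro Z
    refine hker.trans ?_
    rw [← vanishingIdeal_closure T]
    exact vanishingIdeal_anti (closure_mono (by rintro _ ⟨y, _, rfl⟩; exact y.2))
  have hlt : ∀ {I J : Ideal (MvPolynomial σ ℂ)}, RingHom.ker f ≤ I → I < J →
      I.map f < J.map f := by
    intro I J hI hIJ
    have hJ := hI.trans hIJ.le
    refine lt_of_le_of_ne (Ideal.map_mono hIJ.le) fun h => hIJ.ne ?_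
    have := congrArg (Ideal.comap f) h
    rwa [Ideal.comap_map_of_surjective' f hf, Ideal.comap_map_of_surjective' f hf,
      sup_eq_left.2 hI, sup_eq_left.2 hJ] at this
  have hprime : ∀ Z, ((vanishingIdeal (e Z : Set (ProjSpace σ))).map f).IsPrime := fun Z =>
    have := isPrime_vanishingIdeal (e Z).isIrreducible
    Ideal.map_isPrime_of_surjective hf (heT Z)
  have hm : ∀ Z, RingHom.ker f ≤ RingHom.ker (MvPolynomial.eval (0 : σ → ℂ)) := fun Z =>
    (heT Z).trans (vanishingIdeal_lt_ker_eval_zero (e Z).isIrreducible.nonempty).le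
  have := RingHom.ker_isPrime (MvPolynomial.eval (0 : σ → ℂ))
  have hmprime : ((RingHom.ker (MvPolynomial.eval (0 : σ → ℂ))).map f).IsPrime :=
    Ideal.map_isPrime_of_surjective hf (hm (Classical.arbitrary _))
  -- The added bottom element goes to the irrelevant ideal, which lies strictly above all the other
  -- primes used; it accounts for the `+ 1`.
  let g : WithBot (TopologicalSpace.IrreducibleCloseds T) → (PrimeSpectrum A)ᵒᵈ := fun Z =>
    OrderDual.toDual (WithBot.recBotCoe ⟨_, hmprime⟩ (fun Z => ⟨_, hprime Z⟩) Z)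
  have hg : StrictMono g := by
    intro Z Z' hZ
    induction Z' with
    | bot => exact absurd hZ not_lt_bot
    | coe Z' =>
      induction Z with
      | bot =>
        exact hlt (heT Z') (vanishingIdeal_lt_ker_eval_zero (e Z').isIrreducible.nonempty)
      | coe Z =>
        have hZ := he (WithBot.coe_lt_coe.1 hZ)
        refine hlt (heT Z') (lt_of_le_not_ge (vanishingIdeal_anti hZ.le) fun h => ?_)
        exact hZ.not_ge (subset_of_vanishingIdeal_le (e Z).isClosed h)
  have := Order.krullDim_le_of_strictMono g hg
  rwa [Order.krullDim_withBot, Order.krullDim_orderDual] at this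

/-- A chain of irreducible sets whose closures are separated by homogeneous polynomials bounds the
dimension of a closed set from below. -/
theorem le_topologicalKrullDim {T : Set (ProjSpace σ)} (hT : IsClosed T) {m : ℕ}
    (B : ℕ → Set (ProjSpace σ)) (hB : ∀ s ≤ m, IsIrreducible (B s)) (hBT : ∀ s ≤ m, B s ⊆ T)
    (hmono : ∀ s < m, B s ⊆ B (s + 1))
    (hsep : ∀ s < m, ∃ F ∈ vanishingIdeal (B s), (∃ k : ℕ, F.IsHomogeneous k) ∧
      F ∉ vanishingIdeal (B (s + 1))) :
    (m : WithBot ℕ∞) ≤ topologicalKrullDim T := by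
  have hcl : ∀ s ≤ m, closure (B s) ⊆ T := fun s hs => closure_minimal (hBT s hs) hT
  let Y : Fin (m + 1) → TopologicalSpace.IrreducibleCloseds T := fun s =>
    { carrier := Subtype.val ⁻¹' closure (B s)
      isIrreducible' := by
        have h := (hB s (by lia)).closure
        obtain ⟨x, hx⟩ := h.nonempty
        refine ⟨⟨⟨x, hcl s (by lia) hx⟩, hx⟩, ?_⟩
        rintro _ _ ⟨u, hu, rfl⟩ ⟨v, hv, rfl⟩ ⟨y, hy, hyu⟩ ⟨z, hz, hzv⟩
        obtain ⟨w, hw, hwuv⟩ := h.isPreirreducible u v hu hv ⟨y, hy, hyu⟩ ⟨z, hz, hzv⟩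
        exact ⟨⟨w, hcl s (by lia) hw⟩, hw, hwuv⟩
      isClosed' := isClosed_closure.preimage continuous_subtype_val }
  have hY : StrictMono Y := by
    rw [Fin.strictMono_iff_lt_succ]
    intro s
    obtain ⟨F, hF, -, hF'⟩ := hsep s s.2
    refine lt_of_le_not_ge (fun x hx => closure_mono (hmono s s.2) hx) fun h => hF' ?_
    rw [← vanishingIdeal_closure] at hF
    exact fun x hx hxB => hF x hx (h (x := ⟨mk x hx, hBT (s + 1) (by lia) hxB⟩)
      (subset_closure (s := B (s + 1)) hxB))
  exact Order.LTSeries.length_le_krullDim (LTSeries.mk m Y hY)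

end ProjSpace

/-- Incomparability: contraction along an integral map is strictly monotone on primes. -/
theorem ringKrullDim_le_of_isIntegral {A B : Type*} [CommRing A] [CommRing B] (f : A →+* B)
    (hf : f.IsIntegral) : ringKrullDim B ≤ ringKrullDim A := by
  let _ : Algebra A B := f.toAlgebra
  have : Algebra.IsIntegral A B := ⟨hf⟩
  exact Order.krullDim_le_of_strictMono
    (fun P : PrimeSpectrum B => (⟨P.asIdeal.comap (algebraMap A B), inferInstance⟩ :
      PrimeSpectrum A)) fun P Q hPQ => Ideal.IsIntegral.comap_lt_comap hPQ

/-- Noether normalization makes the range integral over a polynomial ring; this ring embeds in the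
target, so transcendence degree bounds its number of variables. -/
theorem ringKrullDim_range_le {k : Type} [Field k] {σ ι : Type} [Finite σ] [Finite ι]
    (f : MvPolynomial σ k →ₐ[k] MvPolynomial ι k) :
    ringKrullDim f.range ≤ (Nat.card ι : WithBot ℕ∞) := by
  have : Algebra.FiniteType k f.range :=
    Algebra.FiniteType.of_surjective f.rangeRestrict f.rangeRestrict_surjective
  obtain ⟨s, g, hg, hint⟩ := exists_integral_inj_algHom_of_fg k f.range
  refine (ringKrullDim_le_of_isIntegral (g : MvPolynomial (Fin s) k →+* f.range) hint).trans ?_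
  rw [MvPolynomial.ringKrullDim_of_isNoetherianRing, ringKrullDim_eq_zero_of_field, zero_add]
  have h := trdeg_le_of_injective (f.range.val.comp g)
    (Subtype.val_injective.comp hg)
  rw [MvPolynomial.trdeg_of_isDomain, MvPolynomial.trdeg_of_isDomain, Cardinal.lift_id,
    Cardinal.lift_id, ← Nat.cast_card, ← Nat.cast_card, Nat.cast_le] at h
  exact_mod_cast h

theorem eval_bind₁_apply {σ ι : Type} (P : σ → MvPolynomial ι ℂ) (F : MvPolynomial σ ℂ)
    (x : ι → ℂ) : MvPolynomial.eval x (MvPolynomial.bind₁ P F)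
      = MvPolynomial.eval (fun i => MvPolynomial.eval x (P i)) F := by
  induction F using MvPolynomial.induction_on with
  | C a => simp
  | add p q hp hq => simp_all
  | mul_X p i hp => simp_all

theorem eval_aeval_apply {ι : Type} (P : ι → Polynomial ℂ) (F : MvPolynomial ι ℂ) (s : ℂ) :
    (MvPolynomial.aeval P F).eval s = MvPolynomial.eval (fun i => (P i).eval s) F := by
  induction F using MvPolynomial.induction_on with
  | C a => simp
  | add p q hp hq => simp_all
  | mul_X p i hp => simp_all

/-! ### Polynomial functions and closures of their projective images. -/

/-- Functions on affine space given by a polynomial. -/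
def IsPolynomialFun {ι : Type} (g : (ι → ℂ) → ℂ) : Prop :=
  ∃ P : MvPolynomial ι ℂ, ∀ x, MvPolynomial.eval x P = g x

namespace IsPolynomialFun

variable {ι : Type} {g h : (ι → ℂ) → ℂ}

theorem const (c : ℂ) : IsPolynomialFun fun _ : ι → ℂ => c :=
  ⟨MvPolynomial.C c, fun _ => MvPolynomial.eval_C c⟩

theorem coord (i : ι) : IsPolynomialFun fun x : ι → ℂ => x i :=
  ⟨MvPolynomial.X i, fun _ => MvPolynomial.eval_X i⟩

theorem mul (hg : IsPolynomialFun g) (hh : IsPolynomialFun h) :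
    IsPolynomialFun fun x => g x * h x := by
  obtain ⟨P, hP⟩ := hg
  obtain ⟨Q, hQ⟩ := hh
  exact ⟨P * Q, fun x => by rw [map_mul, hP, hQ]⟩

theorem sum {κ : Type} (s : Finset κ) {g : κ → (ι → ℂ) → ℂ} (hg : ∀ k ∈ s, IsPolynomialFun (g k)) :
    IsPolynomialFun fun x => ∑ k ∈ s, g k x := by
  choose! P hP using hg
  exact ⟨∑ k ∈ s, P k, fun x => by rw [map_sum]; exact Finset.sum_congr rfl fun k hk => hP k hk x⟩

theorem comp {κ : Type} (hg : IsPolynomialFun g) {u : (κ → ℂ) → ι → ℂ}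
    (hu : ∀ i, IsPolynomialFun fun x => u x i) : IsPolynomialFun fun x => g (u x) := by
  obtain ⟨P, hP⟩ := hg
  choose Q hQ using hu
  refine ⟨MvPolynomial.bind₁ Q P, fun x => ?_⟩
  beta_reduce
  rw [← hP, eval_bind₁_apply]
  exact congrArg (fun y => MvPolynomial.eval y P) (funext fun i => hQ i x)

/-- A polynomial function on a line is zero at a point as soon as it vanishes at all but finitely
many points of the line. -/
theorem eq_zero_of_line (hg : IsPolynomialFun g) (x v : ι → ℂ) {S : Set ℂ} (hS : S.Finite)
    (h : ∀ s ∉ S, g (x + s • v) = 0) : g x = 0 := by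
  obtain ⟨P, hP⟩ := hg
  let Q : Polynomial ℂ := MvPolynomial.aeval
    (fun i => Polynomial.C (x i) + Polynomial.X * Polynomial.C (v i)) P
  have hQ : ∀ s, Q.eval s = g (x + s • v) := by
    intro s
    rw [← hP, eval_aeval_apply]
    congr 2
    ext i
    simp only [Polynomial.eval_add, Polynomial.eval_mul, Polynomial.eval_C, Polynomial.eval_X,
      Pi.add_apply, Pi.smul_apply, smul_eq_mul]
  have hQ0 : Q = 0 := by
    refine Polynomial.eq_zero_of_infinite_isRoot _ (Set.Infinite.mono (s := Sᶜ) ?_ hS.infinite_compl)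
    intro s hs
    rw [Set.mem_ofPred_eq, Polynomial.IsRoot, hQ]
    exact h s hs
  have := hQ 0
  rwa [hQ0, Polynomial.eval_zero, zero_smul, add_zero, eq_comm] at this

end IsPolynomialFun

namespace ProjSpace

variable {ι σ : Type}

/-- The image in projective space of a map to the affine cone. -/
def image (G : (ι → ℂ) → σ → ℂ) : Set (ProjSpace σ) :=
  {p | ∃ x, ∃ h : G x ≠ 0, p = mk (G x) h}

theorem mk_mem_image {G : (ι → ℂ) → σ → ℂ} {x : ι → ℂ} (h : G x ≠ 0) : mk (G x) h ∈ image G :=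
  ⟨x, h, rfl⟩

theorem exists_smul_of_mk_mem_image {G : (ι → ℂ) → σ → ℂ} {y : σ → ℂ} {hy : y ≠ 0}
    (h : mk y hy ∈ image G) : ∃ (s : ℂ) (x : ι → ℂ), y = s • G x := by
  obtain ⟨x, hx, he⟩ := h
  obtain ⟨s, hs⟩ := (Projectivization.mk_eq_mk_iff' ℂ _ _ hy hx).1 he
  exact ⟨s, x, hs.symm⟩

theorem isIrreducible_image {G : (ι → ℂ) → σ → ℂ} (hG : ∀ i, IsPolynomialFun fun x => G x i)
    (hne : ∃ x, G x ≠ 0) : IsIrreducible (image G) := by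
  obtain ⟨x₀, hx₀⟩ := hne
  obtain ⟨i₀, hi₀⟩ := Function.ne_iff.1 hx₀
  refine ⟨⟨_, mk_mem_image hx₀⟩, isPreirreducible_iff_isClosed_union_isClosed.2 ?_⟩
  intro Z Z' hZ hZ' hsub
  by_contra! hcon
  have key : ∀ W : Set (ProjSpace σ), IsClosed W → ¬ image G ⊆ W →
      ∃ F : MvPolynomial σ ℂ, F ∈ vanishingIdeal W ∧ ∃ x, MvPolynomial.eval (G x) F ≠ 0 := by
    intro W hW hGW
    obtain ⟨_, ⟨x, hx, rfl⟩, hxW⟩ := Set.not_subset.1 hGW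
    rw [← hW.closure_eq, mk_mem_closure_iff] at hxW
    push Not at hxW
    obtain ⟨F, k, -, hFW, hF⟩ := hxW
    exact ⟨F, hFW, x, hF⟩
  obtain ⟨F, hFZ, x, hx⟩ := key Z hZ hcon.1
  obtain ⟨F', hFZ', x', hx'⟩ := key Z' hZ' hcon.2
  obtain ⟨P, hP⟩ := IsPolynomialFun.comp (g := fun y => MvPolynomial.eval y F) ⟨F, fun _ => rfl⟩ hG
  obtain ⟨P', hP'⟩ :=
    IsPolynomialFun.comp (g := fun y => MvPolynomial.eval y F') ⟨F', fun _ => rfl⟩ hG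
  obtain ⟨Q, hQ⟩ := hG i₀
  have hne : ∀ {P : MvPolynomial ι ℂ} {x : ι → ℂ}, MvPolynomial.eval x P ≠ 0 → P ≠ 0 := by
    rintro P x h rfl
    exact h (map_zero _)
  -- The third factor, the coordinate `i₀` of `G`, kills the parameters `z` at which `G z` might
  -- define no projective point.
  refine mul_ne_zero (mul_ne_zero (hne ((hP x).trans_ne hx)) (hne ((hP' x').trans_ne hx')))
    (hne ((hQ x₀).trans_ne hi₀)) (MvPolynomial.funext fun z => ?_)
  rw [map_zero, map_mul, map_mul, hP, hP', hQ]
  beta_reduce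
  by_cases hz : G z i₀ = 0
  · rw [hz, mul_zero]
  have hGz : G z ≠ 0 := fun h => hz (congrFun h i₀)
  rcases hsub (mk_mem_image hGz) with h | h
  · rw [hFZ _ hGz h, zero_mul, zero_mul]
  · rw [hFZ' _ hGz h, mul_zero, zero_mul]

theorem mem_vanishingIdeal_image {G : (ι → ℂ) → σ → ℂ} {F : MvPolynomial σ ℂ} {k : ℕ}
    (hF : F.IsHomogeneous k) (h : ∀ x, G x ≠ 0 → MvPolynomial.eval (G x) F = 0) :
    F ∈ vanishingIdeal (image G) := by
  intro y hy hyG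
  obtain ⟨s, x, rfl⟩ := exists_smul_of_mk_mem_image hyG
  rw [eval_smul_of_isHomogeneous hF, h x fun h0 => hy (by rw [h0, smul_zero]), mul_zero]

/-- The dimension of the closure of a conical polynomial image is less than the number of
parameters. -/
theorem topologicalKrullDim_closure_image_add_one_le [Finite ι] [Finite σ]
    {G : (ι → ℂ) → σ → ℂ} (hG : ∀ i, IsPolynomialFun fun x => G x i)
    (hne : ∃ x, G x ≠ 0) (hcone : ∀ (s : ℂ) x, ∃ y, G y = s • G x) :
    topologicalKrullDim (closure (image G)) + 1 ≤ (Nat.card ι : WithBot ℕ∞) := by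
  choose P hP using hG
  let f : MvPolynomial σ ℂ →ₐ[ℂ] MvPolynomial ι ℂ := MvPolynomial.bind₁ P
  refine (topologicalKrullDim_add_one_le (isIrreducible_image (fun i => ⟨P i, hP i⟩) hne).closure
    (f.rangeRestrict : MvPolynomial σ ℂ →+* f.range) f.rangeRestrict_surjective
    fun F hF => ?_).trans (ringKrullDim_range_le f)
  have hF : f F = 0 := congrArg Subtype.val hF
  rw [vanishingIdeal_closure]
  intro y hy hyG
  obtain ⟨s, x, rfl⟩ := exists_smul_of_mk_mem_image hyG
  obtain ⟨z, hz⟩ := hcone s x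
  have := congrArg (MvPolynomial.eval z) hF
  rw [show f F = MvPolynomial.bind₁ P F from rfl, eval_bind₁_apply, map_zero] at this
  rw [← hz, ← this]
  exact congrArg (fun y => MvPolynomial.eval y F) (funext fun i => (hP i z).symm)

theorem topologicalKrullDim_add_one_le_card [Finite σ] {T : Set (ProjSpace σ)}
    (hT : IsIrreducible T) : topologicalKrullDim T + 1 ≤ (Nat.card σ : WithBot ℕ∞) := by
  refine (topologicalKrullDim_add_one_le hT (RingHom.id (MvPolynomial σ ℂ))
    Function.surjective_id ?_).trans ?_
  · intro F hF
    rw [show F = 0 from hF]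
    exact zero_mem _
  · rw [MvPolynomial.ringKrullDim_of_isNoetherianRing, ringKrullDim_eq_zero_of_field, zero_add]

end ProjSpace

/-! ### Binary tensors and frames in isotropic coordinates. -/

/-- The coordinates of `ℂ²` in terms of the isotropic coordinate `X = (v₁ + i v₂) / (v₁ - i v₂)`,
normalized by `v₁ - i v₂ = 1`. -/
noncomputable def isotropicCoord : Fin 2 → Polynomial ℂ :=
  ![Polynomial.C (1 / 2) * (Polynomial.X + 1),
    Polynomial.C (-Complex.I / 2) * (Polynomial.X - 1)]

/-- The monomials of degree `d` in the coordinates of `ℂ²`, in terms of the isotropic coordinate. -/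
noncomputable def isotropicMonomial {d : ℕ} (s : Sym (Fin 2) d) : Polynomial ℂ :=
  ((s : Multiset (Fin 2)).map isotropicCoord).prod

/-- The symmetric tensor with entries `t 0, …, t d` in isotropic coordinates. -/
noncomputable def seqTensor (d : ℕ) (t : ℕ → ℂ) : SymTensor 2 d :=
  fun s => ∑ k ∈ Finset.range (d + 1), (isotropicMonomial s).coeff k * t k

theorem natDegree_isotropicCoord_le (i : Fin 2) : (isotropicCoord i).natDegree ≤ 1 := by
  fin_cases i
  · exact (Polynomial.natDegree_C_mul_le _ _).trans (Polynomial.natDegree_X_add_C (1 : ℂ)).le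
  · exact (Polynomial.natDegree_C_mul_le _ _).trans (Polynomial.natDegree_X_sub_C (1 : ℂ)).le

theorem natDegree_isotropicMonomial_le {d : ℕ} (s : Sym (Fin 2) d) :
    (isotropicMonomial s).natDegree ≤ d := by
  refine (Polynomial.natDegree_multiset_prod_le _).trans ?_
  refine (Multiset.sum_le_card_nsmul _ 1 ?_).trans (by simp)
  intro x hx
  simp only [Multiset.mem_map] at hx
  obtain ⟨_, ⟨i, -, rfl⟩, rfl⟩ := hx
  exact natDegree_isotropicCoord_le i

theorem seqTensor_smul (d : ℕ) (c : ℂ) (t : ℕ → ℂ) :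
    seqTensor d (c • t) = c • seqTensor d t := by
  ext s
  simp only [seqTensor, Pi.smul_apply, smul_eq_mul, Finset.mul_sum]
  exact Finset.sum_congr rfl fun k _ => by ring

theorem seqTensor_sum_geom (d : ℕ) {κ : Type} [Fintype κ] (μ u : κ → ℂ) (s : Sym (Fin 2) d) :
    seqTensor d (fun n => ∑ j, μ j * u j ^ n) s
      = ∑ j, μ j * (isotropicMonomial s).eval (u j) := by
  simp only [seqTensor, Finset.mul_sum]
  rw [Finset.sum_comm]
  refine Finset.sum_congr rfl fun j _ => ?_
  rw [Polynomial.eval_eq_sum_range' (Nat.lt_succ_of_le (natDegree_isotropicMonomial_le s)),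
    Finset.mul_sum]
  exact Finset.sum_congr rfl fun k _ => by ring

/-- Both `1` and `X` are combinations of the two coordinates, so multiplying by them raises the
tensor order while keeping or raising the power of `X`. -/
theorem X_pow_mem_span_isotropicMonomial (d : ℕ) : ∀ k ≤ d, (Polynomial.X : Polynomial ℂ) ^ k ∈
    Submodule.span ℂ (Set.range (isotropicMonomial : Sym (Fin 2) d → Polynomial ℂ)) := by
  induction d with
  | zero =>
    intro k hk
    refine Submodule.subset_span ⟨Sym.nil, ?_⟩
    simp [isotropicMonomial, Nat.le_zero.1 hk]
  | succ d ih =>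
    have hmul : ∀ (i : Fin 2) (P : Polynomial ℂ),
        P ∈ Submodule.span ℂ (Set.range (isotropicMonomial : Sym (Fin 2) d → Polynomial ℂ)) →
        isotropicCoord i * P ∈
          Submodule.span ℂ (Set.range (isotropicMonomial : Sym (Fin 2) (d + 1) → _)) := by
      intro i P hP
      induction hP using Submodule.span_induction with
      | mem P hP =>
        obtain ⟨s, rfl⟩ := hP
        exact Submodule.subset_span ⟨i ::ₛ s, by simp [isotropicMonomial, Sym.coe_cons]⟩
      | zero => simp
      | add P Q _ _ hP hQ => rw [mul_add]; exact add_mem hP hQ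
      | smul c P _ hP => rw [mul_smul_comm]; exact Submodule.smul_mem _ _ hP
    have hI : Complex.I * (-Complex.I / 2) = 1 / 2 := by
      linear_combination (-1 / 2 : ℂ) * Complex.I_mul_I
    have h0 : isotropicCoord 0 - Complex.I • isotropicCoord 1 = 1 := by
      simp only [isotropicCoord, Matrix.cons_val_zero, Matrix.cons_val_one,
        Polynomial.smul_eq_C_mul, ← mul_assoc, ← Polynomial.C_mul, hI]
      rw [← mul_sub, show (Polynomial.X + 1 - (Polynomial.X - 1) : Polynomial ℂ)
        = Polynomial.C 2 by rw [Polynomial.C_ofNat]; ring, ← Polynomial.C_mul]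
      norm_num
    have h1 : isotropicCoord 0 + Complex.I • isotropicCoord 1 = Polynomial.X := by
      simp only [isotropicCoord, Matrix.cons_val_zero, Matrix.cons_val_one,
        Polynomial.smul_eq_C_mul, ← mul_assoc, ← Polynomial.C_mul, hI]
      rw [← mul_add, show (Polynomial.X + 1 + (Polynomial.X - 1) : Polynomial ℂ)
        = Polynomial.C 2 * Polynomial.X by rw [Polynomial.C_ofNat]; ring, ← mul_assoc,
        ← Polynomial.C_mul]
      norm_num
    intro k hk
    rcases hk.lt_or_eq with hk | rfl
    · rw [← one_mul (Polynomial.X ^ k), ← h0, sub_mul, smul_mul_assoc]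
      exact sub_mem (hmul 0 _ (ih k (by lia))) (Submodule.smul_mem _ _ (hmul 1 _ (ih k (by lia))))
    · nth_rewrite 1 [pow_succ', ← h1]
      rw [add_mul, smul_mul_assoc]
      exact add_mem (hmul 0 _ (ih d le_rfl)) (Submodule.smul_mem _ _ (hmul 1 _ (ih d le_rfl)))

/-- The entries in isotropic coordinates are linear forms in the tensor. -/
theorem exists_linearForm_eval_seqTensor {d k : ℕ} (hk : k ≤ d) :
    ∃ L : MvPolynomial (Sym (Fin 2) d) ℂ, L.IsHomogeneous 1 ∧
      ∀ t : ℕ → ℂ, MvPolynomial.eval (seqTensor d t) L = t k := by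
  obtain ⟨c, hc⟩ := (Submodule.mem_span_range_iff_exists_fun ℂ).1
    (X_pow_mem_span_isotropicMonomial d k hk)
  refine ⟨∑ s, MvPolynomial.C (c s) * MvPolynomial.X s, MvPolynomial.IsHomogeneous.sum _ _ _
    fun s _ => MvPolynomial.isHomogeneous_C_mul_X _ _, fun t => ?_⟩
  have h : ∀ m, ∑ s, c s * (isotropicMonomial s).coeff m = if m = k then 1 else 0 := by
    intro m
    have := congrArg (fun P => Polynomial.coeff P m) hc
    simpa [Polynomial.finsetSum_coeff, Polynomial.coeff_X_pow] using this
  simp only [map_sum, map_mul, MvPolynomial.eval_C, MvPolynomial.eval_X, seqTensor,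
    Finset.mul_sum]
  rw [Finset.sum_comm]
  simp only [← mul_assoc, ← Finset.sum_mul, h]
  simp [Nat.lt_succ_of_le hk]

theorem seqTensor_ne_zero {d k : ℕ} (hk : k ≤ d) {t : ℕ → ℂ} (ht : t k ≠ 0) :
    seqTensor d t ≠ 0 := by
  intro h
  obtain ⟨L, hL, hLt⟩ := exists_linearForm_eval_seqTensor hk
  refine ht ?_
  rw [← hLt t, h, ← zero_smul ℂ (0 : SymTensor 2 d),
    ProjSpace.eval_smul_of_isHomogeneous hL, pow_one, zero_mul]

/-- Each column is `w` times the normalized vector with isotropic coordinate `z / w = z²`, since `z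
w = 1`; the `d` factors `w` go into the weight. -/
theorem waringTensor_eq_seqTensor {r : ℕ} (d : ℕ) (lam : Fin r → ℂ) (V : Matrix (Fin 2) (Fin r) ℂ)
    (hV : ∀ j, V 0 j ^ 2 + V 1 j ^ 2 = 1) :
    waringTensor d lam V = seqTensor d fun n => ∑ j,
      (lam j * (V 0 j - Complex.I * V 1 j) ^ d) * ((V 0 j + Complex.I * V 1 j) ^ 2) ^ n := by
  ext s
  rw [seqTensor_sum_geom]
  refine Finset.sum_congr rfl fun j _ => ?_
  have hI := Complex.I_mul_I
  have hzw : (V 0 j - Complex.I * V 1 j) * (V 0 j + Complex.I * V 1 j) = 1 := by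
    linear_combination hV j - V 1 j ^ 2 * hI
  have hi : ∀ i : Fin 2, V i j = (V 0 j - Complex.I * V 1 j)
      * (isotropicCoord i).eval ((V 0 j + Complex.I * V 1 j) ^ 2) := by
    intro i
    fin_cases i
    · simp [isotropicCoord]
      linear_combination (-1 / 2 : ℂ) * (V 0 j + Complex.I * V 1 j) * hzw
    · simp [isotropicCoord]
      linear_combination (Complex.I / 2 : ℂ) * (V 0 j + Complex.I * V 1 j) * hzw + V 1 j * hI
  rw [mul_assoc]
  congr 1
  have hcard : (s : Multiset (Fin 2)).card = d := s.2
  rw [isotropicMonomial, ← Polynomial.coe_evalRingHom, map_multiset_prod, Multiset.map_map]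
  conv_lhs => rw [Multiset.map_congr rfl fun i _ => hi i]
  rw [Multiset.prod_map_mul, Multiset.map_const', Multiset.prod_replicate, hcard]
  rfl

/-- The sums of `z²` and `w²` encode the difference of the diagonal entries and the off-diagonal
entry of `V Vᵀ`; its trace is `r` by the norm conditions. -/
theorem mem_funtfVariety_two_iff {r : ℕ} (V : Matrix (Fin 2) (Fin r) ℂ) :
    V ∈ funtfVariety r 2 ↔ (∀ j, V 0 j ^ 2 + V 1 j ^ 2 = 1) ∧
      ∑ j, (V 0 j + Complex.I * V 1 j) ^ 2 = 0 ∧ ∑ j, (V 0 j - Complex.I * V 1 j) ^ 2 = 0 := by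
  have hI := Complex.I_mul_I
  have e1 : ∑ j, (V 0 j + Complex.I * V 1 j) ^ 2
      = ∑ j, V 0 j * V 0 j + 2 * Complex.I * ∑ j, V 0 j * V 1 j - ∑ j, V 1 j * V 1 j := by
    rw [Finset.mul_sum, ← Finset.sum_add_distrib, ← Finset.sum_sub_distrib]
    exact Finset.sum_congr rfl fun j _ => by linear_combination V 1 j ^ 2 * hI
  have e2 : ∑ j, (V 0 j - Complex.I * V 1 j) ^ 2
      = ∑ j, V 0 j * V 0 j - 2 * Complex.I * ∑ j, V 0 j * V 1 j - ∑ j, V 1 j * V 1 j := by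
    rw [Finset.mul_sum, ← Finset.sum_sub_distrib, ← Finset.sum_sub_distrib]
    exact Finset.sum_congr rfl fun j _ => by linear_combination V 1 j ^ 2 * hI
  have e3 : ∑ j, V 1 j * V 0 j = ∑ j, V 0 j * V 1 j :=
    Finset.sum_congr rfl fun j _ => mul_comm _ _
  simp only [funtfVariety, Set.mem_ofPred_eq, Fin.sum_univ_two]
  rw [and_comm, ← Matrix.ext_iff]
  refine and_congr_right fun hV => ?_
  have e4 : ∑ j, V 0 j * V 0 j + ∑ j, V 1 j * V 1 j = r := by
    rw [← Finset.sum_add_distrib, Finset.sum_congr rfl fun j _ => show _ = (1 : ℂ) by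
      rw [← hV j]; ring]
    simp
  simp only [Fin.forall_fin_two, Matrix.mul_apply, Matrix.transpose_apply, Matrix.smul_apply,
    Matrix.one_apply, e1, e2, e3]
  norm_num
  constructor
  · rintro ⟨⟨h00, h01⟩, -, h11⟩
    rw [h00, h01, h11]
    norm_num
  · rintro ⟨h1, h2⟩
    have h01 : ∑ j, V 0 j * V 1 j = 0 := by
      have : Complex.I * ∑ j, V 0 j * V 1 j = 0 := by linear_combination (h1 - h2) / 4
      simpa using this
    exact ⟨⟨by linear_combination (h1 + h2) / 4 + e4 / 2, h01⟩, h01,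
      by linear_combination -(h1 + h2) / 4 + e4 / 2⟩

/-! ### Linear recurrences with two missing coefficients; here `r = R + 3`. -/

/-- A linear recurrence of order `R + 3` in which the coefficients of index `1` and `R + 2` vanish,
together with initial values. -/
abbrev RecParam (R : ℕ) : Type := Fin (R + 1) ⊕ Fin (R + 3)

/-- The coefficients of the recurrence. -/
def recCoeff {R : ℕ} (x : RecParam R → ℂ) (j : Fin (R + 3)) : ℂ :=
  -- Truncated subtraction sends `0` to `0` and `2, …, R + 1` to `1, …, R`, a bijection onto the
  -- slots.
  if h : (j : ℕ) ≤ R + 1 ∧ (j : ℕ) ≠ 1 then x (Sum.inl ⟨j - 1, by lia⟩) else 0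

/-- The solution of the recurrence. -/
def recSeq {R : ℕ} (x : RecParam R → ℂ) : ℕ → ℂ :=
  (⟨R + 3, recCoeff x⟩ : LinearRecurrence ℂ).mkSol fun k => x (Sum.inr k)

variable {R : ℕ}

theorem recSeq_of_lt (x : RecParam R → ℂ) {n : ℕ} (hn : n < R + 3) :
    recSeq x n = x (Sum.inr ⟨n, hn⟩) :=
  LinearRecurrence.mkSol_eq_init (⟨R + 3, recCoeff x⟩ : LinearRecurrence ℂ) _ ⟨n, hn⟩

theorem recSeq_add (x : RecParam R → ℂ) (n : ℕ) :
    recSeq x (n + (R + 3)) = ∑ j : Fin (R + 3), recCoeff x j * recSeq x (n + j) :=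
  LinearRecurrence.is_sol_mkSol (⟨R + 3, recCoeff x⟩ : LinearRecurrence ℂ) _ n

theorem eq_recSeq (x : RecParam R → ℂ) {u : ℕ → ℂ}
    (hinit : ∀ k : Fin (R + 3), u k = x (Sum.inr k))
    (hrec : ∀ n, u (n + (R + 3)) = ∑ j : Fin (R + 3), recCoeff x j * u (n + j)) :
    u = recSeq x :=
  LinearRecurrence.eq_mk_of_is_sol_of_eq_init' (⟨R + 3, recCoeff x⟩ : LinearRecurrence ℂ)
    hrec hinit

theorem isPolynomialFun_recCoeff (j : Fin (R + 3)) :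
    IsPolynomialFun fun x : RecParam R → ℂ => recCoeff x j := by
  unfold recCoeff
  split_ifs with h
  · exact IsPolynomialFun.coord _
  · exact IsPolynomialFun.const 0

theorem isPolynomialFun_recSeq (n : ℕ) :
    IsPolynomialFun fun x : RecParam R → ℂ => recSeq x n := by
  induction n using Nat.strong_induction_on with
  | _ n ih =>
    by_cases hn : n < R + 3
    · simp only [recSeq_of_lt _ hn]
      exact IsPolynomialFun.coord _
    · obtain ⟨m, rfl⟩ := Nat.exists_eq_add_of_le' (not_lt.1 hn)
      simp only [recSeq_add]
      exact IsPolynomialFun.sum _ fun j _ =>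
        (isPolynomialFun_recCoeff j).mul (ih (m + j) (by lia))

/-- The parametrization of the affine cone over the fradeco variety. -/
noncomputable def recTensor (d : ℕ) (x : RecParam R → ℂ) : SymTensor 2 d := seqTensor d (recSeq x)

theorem isPolynomialFun_recTensor (d : ℕ) (s : Sym (Fin 2) d) :
    IsPolynomialFun fun x : RecParam R → ℂ => recTensor d x s :=
  IsPolynomialFun.sum (Finset.range (d + 1))
    (g := fun k x => (isotropicMonomial s).coeff k * recSeq x k) fun k _ => (IsPolynomialFun.const _).mul (isPolynomialFun_recSeq k)

theorem exists_recTensor_eq_smul (d : ℕ) (c : ℂ) (x : RecParam R → ℂ) :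
    ∃ y : RecParam R → ℂ, recTensor d y = c • recTensor d x := by
  refine ⟨Sum.elim (fun l => x (Sum.inl l)) fun k => c * x (Sum.inr k), ?_⟩
  rw [recTensor, recTensor, ← seqTensor_smul]
  congr 1
  symm
  refine eq_recSeq _ (fun k => ?_) fun n => ?_
  · rw [Pi.smul_apply, recSeq_of_lt x k.2]
    rfl
  · rw [Pi.smul_apply, recSeq_add, smul_eq_mul, Finset.mul_sum]
    refine Finset.sum_congr rfl fun j _ => ?_
    simp only [recCoeff, Sum.elim_inl, Pi.smul_apply, smul_eq_mul]
    ring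

theorem recTensor_ne_zero (d : ℕ) : ∃ x : RecParam R → ℂ, recTensor d x ≠ 0 :=
  ⟨fun _ => 1, seqTensor_ne_zero (Nat.zero_le d) (by rw [recSeq_of_lt _ (by lia)]; simp)⟩

/-! ### Characteristic polynomials and the passage between frames and recurrences. -/

/-- The characteristic polynomial of the recurrence. -/
noncomputable def recPoly (x : RecParam R → ℂ) : Polynomial ℂ :=
  Polynomial.X ^ (R + 3) - ∑ j : Fin (R + 3), Polynomial.C (recCoeff x j) * Polynomial.X ^ (j : ℕ)

theorem eval_recPoly (x : RecParam R → ℂ) (u : ℂ) :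
    (recPoly x).eval u = u ^ (R + 3) - ∑ j : Fin (R + 3), recCoeff x j * u ^ (j : ℕ) := by
  simp [recPoly, Polynomial.eval_finsetSum]

theorem degree_recPoly_sub_lt (x : RecParam R → ℂ) :
    (∑ j : Fin (R + 3), Polynomial.C (recCoeff x j) * Polynomial.X ^ (j : ℕ)).degree
      < ((R + 3 : ℕ) : WithBot ℕ) :=
  Polynomial.degree_sum_fin_lt _

theorem monic_recPoly (x : RecParam R → ℂ) : (recPoly x).Monic :=
  Polynomial.monic_X_pow_sub (degree_recPoly_sub_lt x)

theorem natDegree_recPoly (x : RecParam R → ℂ) : (recPoly x).natDegree = R + 3 :=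
  Polynomial.natDegree_eq_of_degree_eq_some <| by
    rw [recPoly, Polynomial.degree_sub_eq_left_of_degree_lt] <;> rw [Polynomial.degree_X_pow]
    exact degree_recPoly_sub_lt x

theorem coeff_recPoly (x : RecParam R → ℂ) (j : Fin (R + 3)) :
    (recPoly x).coeff j = -recCoeff x j := by
  rw [recPoly, Polynomial.coeff_sub, Polynomial.coeff_X_pow, if_neg (by lia),
    Polynomial.finsetSum_coeff]
  simp [Polynomial.coeff_X_pow, Fin.val_inj]

theorem coeff_one_recPoly (x : RecParam R → ℂ) : (recPoly x).coeff 1 = 0 := by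
  have := coeff_recPoly x ⟨1, by lia⟩
  simpa [recCoeff] using this

theorem coeff_pred_recPoly (x : RecParam R → ℂ) : (recPoly x).coeff (R + 2) = 0 := by
  have := coeff_recPoly x ⟨R + 2, by lia⟩
  simpa [recCoeff] using this

/-- Every monic polynomial of degree `R + 3` without terms of degree `1` and `R + 2` is the
characteristic polynomial of one of our recurrences. -/
theorem exists_recPoly_eq {p : Polynomial ℂ} (hp : p.Monic) (hdeg : p.natDegree = R + 3)
    (h1 : p.coeff 1 = 0) (h2 : p.coeff (R + 2) = 0) (τ : Fin (R + 3) → ℂ) :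
    ∃ x : RecParam R → ℂ, recPoly x = p ∧ ∀ k, x (Sum.inr k) = τ k := by
  refine ⟨Sum.elim (fun l => -p.coeff (if (l : ℕ) = 0 then 0 else l + 1)) τ, ?_, fun k => rfl⟩
  ext n
  rcases lt_trichotomy n (R + 3) with hn | rfl | hn
  · rw [coeff_recPoly _ ⟨n, hn⟩]
    simp only [recCoeff]
    split_ifs with h
    · simp only [Sum.elim_inl, neg_neg]
      congr 1
      split_ifs <;> lia
    · have : n = 1 ∨ n = R + 2 := by lia
      rcases this with rfl | rfl
      · rw [h1, neg_zero]
      · rw [h2, neg_zero]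
  · have e1 := (monic_recPoly (R := R)
      (Sum.elim (fun l => -p.coeff (if (l : ℕ) = 0 then 0 else l + 1)) τ)).coeff_natDegree
    have e2 := hp.coeff_natDegree
    rw [natDegree_recPoly] at e1
    rw [hdeg] at e2
    rw [e1, e2]
  · rw [Polynomial.coeff_eq_zero_of_natDegree_lt (by rwa [natDegree_recPoly]),
      Polynomial.coeff_eq_zero_of_natDegree_lt (by rwa [hdeg])]

/-- Combinations of powers of roots of the characteristic polynomial solve the recurrence. -/
theorem sum_geom_eq_recSeq {κ : Type} [Fintype κ] (x : RecParam R → ℂ) (μ u : κ → ℂ)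
    (hu : ∀ j, (recPoly x).eval (u j) = 0)
    (hinit : ∀ k : Fin (R + 3), ∑ j, μ j * u j ^ (k : ℕ) = x (Sum.inr k)) :
    (fun n => ∑ j, μ j * u j ^ n) = recSeq x := by
  refine eq_recSeq x hinit fun n => ?_
  simp only [Finset.mul_sum]
  rw [Finset.sum_comm]
  refine Finset.sum_congr rfl fun i _ => ?_
  have := hu i
  rw [eval_recPoly, sub_eq_zero] at this
  rw [pow_add, this, Finset.mul_sum, Finset.mul_sum]
  exact Finset.sum_congr rfl fun j _ => by ring

/-- The linear coefficient is the derivative at `0`, evaluated by the product rule. -/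
theorem coeff_one_prod_X_sub_C {κ : Type} [Fintype κ] {u : κ → ℂ} (hu : ∀ j, u j ≠ 0) :
    (∏ j, (Polynomial.X - Polynomial.C (u j))).coeff 1 = -(∏ j, -u j) * ∑ j, (u j)⁻¹ := by
  classical
  have h : (∏ j, (Polynomial.X - Polynomial.C (u j))).coeff 1
      = (Polynomial.derivative (∏ j, (Polynomial.X - Polynomial.C (u j)))).eval 0 := by
    rw [← Polynomial.coeff_zero_eq_eval_zero, Polynomial.coeff_derivative]
    simp
  rw [h, Polynomial.derivative_prod_finset, Polynomial.eval_finsetSum, Finset.mul_sum]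
  refine Finset.sum_congr rfl fun j _ => ?_
  rw [Polynomial.derivative_X_sub_C, mul_one, Polynomial.eval_prod,
    ← Finset.mul_prod_erase Finset.univ (fun j => -u j) (Finset.mem_univ j)]
  simp only [Polynomial.eval_sub, Polynomial.eval_X, Polynomial.eval_C, zero_sub]
  field_simp [hu j]

theorem coeff_pred_prod_X_sub_C (u : Fin (R + 3) → ℂ) :
    (∏ j, (Polynomial.X - Polynomial.C (u j))).coeff (R + 2) = -∑ j, u j := by
  have := Polynomial.prod_X_sub_C_coeff_card_pred Finset.univ u (by simp)
  simpa using this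

theorem recTensor_of_mem_funtfVariety {d : ℕ} {V : Matrix (Fin 2) (Fin (R + 3)) ℂ}
    (hV : V ∈ funtfVariety (R + 3) 2) (lam : Fin (R + 3) → ℂ) :
    ∃ x : RecParam R → ℂ, recTensor d x = waringTensor d lam V := by
  obtain ⟨h1, hz, hw⟩ := (mem_funtfVariety_two_iff V).1 hV
  let u : Fin (R + 3) → ℂ := fun j => (V 0 j + Complex.I * V 1 j) ^ 2
  let μ : Fin (R + 3) → ℂ := fun j => lam j * (V 0 j - Complex.I * V 1 j) ^ d
  have hzw : ∀ j, (V 0 j + Complex.I * V 1 j) * (V 0 j - Complex.I * V 1 j) = 1 := fun j => by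
    linear_combination h1 j - V 1 j ^ 2 * Complex.I_mul_I
  have hu : ∀ j, u j ≠ 0 := fun j => pow_ne_zero 2 (left_ne_zero_of_mul_eq_one (hzw j))
  have hinv : ∀ j, (u j)⁻¹ = (V 0 j - Complex.I * V 1 j) ^ 2 := fun j =>
    inv_eq_of_mul_eq_one_right (by rw [← mul_pow, hzw, one_pow])
  obtain ⟨x, hx, hτ⟩ := exists_recPoly_eq (R := R)
    (p := ∏ j, (Polynomial.X - Polynomial.C (u j)))
    (Polynomial.monic_prod_X_sub_C u _) (by simp)
    (by rw [coeff_one_prod_X_sub_C hu, Finset.sum_congr rfl fun j _ => hinv j, hw, mul_zero])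
    (by rw [coeff_pred_prod_X_sub_C, hz, neg_zero])
    (fun k => ∑ j, μ j * u j ^ (k : ℕ))
  refine ⟨x, ?_⟩
  rw [waringTensor_eq_seqTensor d lam V h1, recTensor,
    ← sum_geom_eq_recSeq x μ u (fun j => ?_) fun k => (hτ k).symm]
  rw [hx, Polynomial.eval_prod]
  exact Finset.prod_eq_zero (Finset.mem_univ j) (by simp)

theorem exists_funtf_of_isotropic {d : ℕ} (u μ : Fin (R + 3) → ℂ) (hu : ∀ j, u j ≠ 0)
    (h1 : ∑ j, u j = 0) (h2 : ∑ j, (u j)⁻¹ = 0) :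
    ∃ V ∈ funtfVariety (R + 3) 2, ∃ lam : Fin (R + 3) → ℂ,
      waringTensor d lam V = seqTensor d fun n => ∑ j, μ j * u j ^ n := by
  -- The column is to have `v₁ + i v₂ = z j` and `v₁ - i v₂ = (z j)⁻¹`; either square root of `u j`
  -- works.
  choose z hz using fun j => IsAlgClosed.exists_pow_nat_eq (u j) (n := 2) (by lia)
  have hz0 : ∀ j, z j ≠ 0 := fun j h => hu j (by rw [← hz, h]; simp)
  have hI := Complex.I_mul_I
  let V : Matrix (Fin 2) (Fin (R + 3)) ℂ := Matrix.of
    ![fun j => (z j + (z j)⁻¹) / 2, fun j => -Complex.I * (z j - (z j)⁻¹) / 2]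
  have hV0 : ∀ j, V 0 j = (z j + (z j)⁻¹) / 2 := fun j => rfl
  have hV1 : ∀ j, V 1 j = -Complex.I * (z j - (z j)⁻¹) / 2 := fun j => rfl
  have hplus : ∀ j, V 0 j + Complex.I * V 1 j = z j := fun j => by
    rw [hV0, hV1]
    linear_combination -(z j - (z j)⁻¹) / 2 * hI
  have hminus : ∀ j, V 0 j - Complex.I * V 1 j = (z j)⁻¹ := fun j => by
    rw [hV0, hV1]
    linear_combination (z j - (z j)⁻¹) / 2 * hI
  have hV : ∀ j, V 0 j ^ 2 + V 1 j ^ 2 = 1 := fun j => by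
    have : (V 0 j + Complex.I * V 1 j) * (V 0 j - Complex.I * V 1 j) = 1 := by
      rw [hplus, hminus, mul_inv_cancel₀ (hz0 j)]
    linear_combination this + V 1 j ^ 2 * hI
  refine ⟨V, (mem_funtfVariety_two_iff V).2 ⟨hV, ?_, ?_⟩, fun j => μ j * z j ^ d, ?_⟩
  · simp only [hplus, hz, h1]
  · simp only [hminus, inv_pow, hz, h2]
  · rw [waringTensor_eq_seqTensor d _ V hV]
    simp only [hplus, hminus, hz]
    congr 1
    ext n
    refine Finset.sum_congr rfl fun j _ => ?_
    rw [mul_assoc (μ j), ← mul_pow, mul_inv_cancel₀ (hz0 j), one_pow, mul_one]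

/-- If the characteristic polynomial has simple nonzero roots, the solutions of the recurrence are
given by points of the funtf variety. -/
theorem exists_funtf_of_simple_roots {d : ℕ} (x : RecParam R → ℂ)
    (h0 : (recPoly x).eval 0 ≠ 0)
    (hsimple : ∀ ξ, (recPoly x).eval ξ = 0 → (Polynomial.derivative (recPoly x)).eval ξ ≠ 0) :
    ∃ V ∈ funtfVariety (R + 3) 2, ∃ lam : Fin (R + 3) → ℂ,
      waringTensor d lam V = recTensor d x := by
  classical
  have hp := monic_recPoly x
  have hnodup : (recPoly x).roots.Nodup := by
    rw [Multiset.nodup_iff_count_le_one]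
    intro ξ
    rw [Polynomial.count_roots]
    by_contra! h
    obtain ⟨hr, hd⟩ := (Polynomial.one_lt_rootMultiplicity_iff_isRoot hp.ne_zero).1 h
    exact hsimple ξ hr hd
  have hcard : (recPoly x).roots.toFinset.card = R + 3 := by
    rw [Multiset.toFinset_card_of_nodup hnodup,
      ← (IsAlgClosed.splits (recPoly x)).natDegree_eq_card_roots, natDegree_recPoly]
  let e := ((recPoly x).roots.toFinset.equivFinOfCardEq hcard).symm
  let u : Fin (R + 3) → ℂ := fun j => e j
  have hroot : ∀ j, (recPoly x).eval (u j) = 0 := fun j =>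
    Polynomial.isRoot_of_mem_roots (Multiset.mem_toFinset.1 (e j).2)
  have hprod : recPoly x = ∏ j, (Polynomial.X - Polynomial.C (u j)) := by
    rw [e.prod_comp fun a => Polynomial.X - Polynomial.C (a : ℂ),
      Finset.prod_coe_sort _ fun a => Polynomial.X - Polynomial.C a,
      Finset.prod_eq_multiset_prod, Multiset.toFinset_val, hnodup.dedup]
    exact ((IsAlgClosed.splits (recPoly x)).eq_prod_roots_of_monic hp)
  have hu : ∀ j, u j ≠ 0 := fun j h => h0 (h ▸ hroot j)
  have hinj : Function.Injective u := Subtype.val_injective.comp e.injective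
  have h1 := coeff_pred_prod_X_sub_C u
  rw [← hprod, coeff_pred_recPoly, eq_comm, neg_eq_zero] at h1
  have h2 := coeff_one_prod_X_sub_C hu
  rw [← hprod, coeff_one_recPoly, eq_comm, mul_eq_zero, neg_eq_zero] at h2
  have h2 := h2.resolve_left
    (Finset.prod_ne_zero_iff.2 fun j _ => neg_ne_zero.2 (hu j))
  have hdet : IsUnit (Matrix.vandermonde u).det :=
    isUnit_iff_ne_zero.2 (Matrix.det_vandermonde_ne_zero_iff.2 hinj)
  let τ : Fin (R + 3) → ℂ := fun k => x (Sum.inr k)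
  -- Distinct roots make the Vandermonde matrix invertible, so the weights can match any initial
  -- values.
  let μ : Fin (R + 3) → ℂ := Matrix.vecMul τ (Matrix.vandermonde u)⁻¹
  have hμ : Matrix.vecMul μ (Matrix.vandermonde u) = τ := by
    rw [Matrix.vecMul_vecMul, Matrix.nonsing_inv_mul _ hdet, Matrix.vecMul_one]
  obtain ⟨V, hV, lam, h⟩ := exists_funtf_of_isotropic (d := d) u μ hu h1 h2
  exact ⟨V, hV, lam, by
    rw [h, recTensor, ← sum_geom_eq_recSeq x μ u hroot fun k => congrFun hμ k]⟩

/-- Changing the constant term of the recurrence shifts the characteristic polynomial. -/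
theorem recPoly_add_smul_single (x : RecParam R → ℂ) (s : ℂ) :
    recPoly (x + s • Pi.single (Sum.inl 0) 1) = recPoly x - Polynomial.C s := by
  have h : ∀ j, recCoeff (x + s • Pi.single (Sum.inl 0) 1) j
      = recCoeff x j + if j = 0 then s else 0 := by
    intro j
    simp only [recCoeff, Pi.add_apply, Pi.smul_apply, Pi.single_apply, Sum.inl.injEq,
      Fin.ext_iff, Fin.val_zero]
    split_ifs <;> first | lia | simp
  simp only [recPoly, h, Polynomial.C_add, add_mul, Finset.sum_add_distrib]
  simp only [apply_ite Polynomial.C, Polynomial.C_0, ite_mul, zero_mul, Finset.sum_ite_eq',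
    Finset.mem_univ, if_true, Fin.val_zero, pow_zero, mul_one]
  ring

/-- For the harder inclusion, move only the constant recurrence coefficient: `p` becomes `p - s`,
which has simple nonzero roots for all but finitely many `s`. -/
theorem fradecoVariety_eq_closure_image (d : ℕ) :
    fradecoVariety (R + 3) 2 d
      = closure (ProjSpace.image (recTensor d : (RecParam R → ℂ) → SymTensor 2 d)) := by
  refine Set.Subset.antisymm (closure_mono ?_) (closure_minimal ?_ isClosed_closure)
  · rintro p ⟨V, hV, lam, h, rfl⟩
    obtain ⟨x, hx⟩ := recTensor_of_mem_funtfVariety (d := d) hV lam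
    exact ⟨x, by rwa [hx], by simp only [hx]⟩
  · rintro p ⟨x, h, rfl⟩
    obtain ⟨i, hi⟩ := Function.ne_iff.1 h
    rw [fradecoVariety, ProjSpace.mk_mem_closure_iff]
    intro F k hF hFv
    have hpoly : IsPolynomialFun fun y : RecParam R → ℂ =>
        MvPolynomial.eval (recTensor d y) F * recTensor d y i :=
      (IsPolynomialFun.comp (g := fun y => MvPolynomial.eval y F) ⟨F, fun _ => rfl⟩
        (isPolynomialFun_recTensor d)).mul (isPolynomialFun_recTensor d i)
    refine (mul_eq_zero.1 (hpoly.eq_zero_of_line x (Pi.single (Sum.inl 0) 1)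
      -- Excluded are `p(0)`, for which `0` is a root of `p - s`, and the critical values of `p`,
      -- for which `p - s` has a multiple root.
      (S := insert ((recPoly x).eval 0)
        ((fun ξ => (recPoly x).eval ξ) '' (Polynomial.derivative (recPoly x)).rootSet ℂ))
      (((Polynomial.rootSet_finite _ _).image _).insert _) fun s hs => ?_)).resolve_right hi
    rw [Set.mem_insert_iff, not_or] at hs
    set y := x + s • Pi.single (Sum.inl 0) 1 with hy
    have hyp : recPoly y = recPoly x - Polynomial.C s := recPoly_add_smul_single x s
    obtain ⟨V, hV, lam, hVy⟩ := exists_funtf_of_simple_roots (d := d) y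
      (by simpa [hyp, sub_eq_zero] using Ne.symm hs.1) (fun ξ hξ hξ' => hs.2 ⟨ξ, by
        have hne : Polynomial.derivative (recPoly x) ≠ 0 := by
          intro h0
          have := Polynomial.derivative_eq_zero.1 h0
          rw [natDegree_recPoly] at this
          lia
        rw [Polynomial.mem_rootSet]
        refine ⟨hne, ?_⟩
        simpa [hyp] using hξ', by simpa [hyp, sub_eq_zero] using hξ⟩)
    by_cases hy0 : recTensor d y = 0
    · rw [hy0, Pi.zero_apply, mul_zero]
    · have := hFv (recTensor d y) hy0 ⟨V, hV, lam, by rwa [hVy], by simp only [hVy]⟩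
      rw [this, zero_mul]

theorem MvPolynomial.isHomogeneous_det {σ A n : Type} [CommRing A] [Fintype n] [DecidableEq n]
    (M : Matrix n n (MvPolynomial σ A)) (hM : ∀ i j, (M i j).IsHomogeneous 1) :
    M.det.IsHomogeneous (Fintype.card n) := by
  rw [Matrix.det_apply']
  refine MvPolynomial.IsHomogeneous.sum _ _ _ fun e _ => ?_
  have h := (MvPolynomial.IsHomogeneous.prod Finset.univ (fun i => M (e i) i) (fun _ => 1)
    fun i _ => hM _ _).C_mul ((Equiv.Perm.sign e : ℤ) : A)
  simpa using h

/-! ### The chain of irreducible sets and its separating forms. -/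

/-- The position of a parameter in the chain of coordinate subspaces. -/
def RecParam.rank : RecParam R → ℕ
  | Sum.inl l => R + 3 + (R - l)
  | Sum.inr k => k

/-- The projection onto the coordinate subspace of the parameters of position at most `s`. -/
def RecParam.trunc (s : ℕ) (x : RecParam R → ℂ) : RecParam R → ℂ :=
  fun v => if v.rank ≤ s then x v else 0

open RecParam

theorem trunc_inl (s : ℕ) (x : RecParam R → ℂ) (l : Fin (R + 1)) :
    trunc s x (Sum.inl l) = if R + 3 + (R - l) ≤ s then x (Sum.inl l) else 0 := rfl

theorem trunc_inr (s : ℕ) (x : RecParam R → ℂ) (k : Fin (R + 3)) :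
    trunc s x (Sum.inr k) = if (k : ℕ) ≤ s then x (Sum.inr k) else 0 := rfl

theorem trunc_trunc_succ (s : ℕ) (x : RecParam R → ℂ) : trunc (s + 1) (trunc s x) = trunc s x := by
  ext v
  simp only [trunc]
  split_ifs <;> first | rfl | lia

/-- The members of the chain of irreducible sets. -/
def chainSet (R d s : ℕ) : Set (ProjSpace (Sym (Fin 2) d)) :=
  ProjSpace.image fun x : RecParam R → ℂ => recTensor d (trunc s x)

theorem isIrreducible_chainSet (R d s : ℕ) : IsIrreducible (chainSet R d s) := by
  refine ProjSpace.isIrreducible_image (fun i => ?_) ⟨fun _ => 1, ?_⟩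
  · refine (isPolynomialFun_recTensor d i).comp fun v => ?_
    simp only [trunc]
    split_ifs
    · exact IsPolynomialFun.coord v
    · exact IsPolynomialFun.const 0
  · refine seqTensor_ne_zero (Nat.zero_le d) ?_
    rw [recSeq_of_lt _ (by lia)]
    simp [trunc_inr]

theorem chainSet_subset_image (R d s : ℕ) :
    chainSet R d s ⊆ ProjSpace.image (recTensor d : (RecParam R → ℂ) → SymTensor 2 d) := by
  rintro _ ⟨x, h, rfl⟩
  exact ⟨trunc s x, h, rfl⟩

theorem chainSet_subset_succ (R d s : ℕ) : chainSet R d s ⊆ chainSet R d (s + 1) := by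
  rintro _ ⟨x, h, rfl⟩
  refine ⟨trunc s x, ?_, ?_⟩ <;> simp only [trunc_trunc_succ]
  exact h

theorem notMem_vanishingIdeal_chainSet {d s : ℕ} {F : MvPolynomial (Sym (Fin 2) d) ℂ}
    {y : RecParam R → ℂ} (hy : trunc s y = y) {k : ℕ} (hk : k ≤ d) (hk0 : recSeq y k ≠ 0)
    (hF : MvPolynomial.eval (recTensor d y) F ≠ 0) :
    F ∉ ProjSpace.vanishingIdeal (chainSet R d s) := by
  have h0 : recTensor d y ≠ 0 := seqTensor_ne_zero hk hk0
  exact fun h => hF (h _ h0 ⟨y, by simpa only [hy] using h0, by simp only [hy]⟩)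

theorem exists_separating_initial {d s : ℕ} (hs : s ≤ R + 1) (hsd : s < d) :
    ∃ F ∈ ProjSpace.vanishingIdeal (chainSet R d s), (∃ k : ℕ, F.IsHomogeneous k) ∧
      F ∉ ProjSpace.vanishingIdeal (chainSet R d (s + 1)) := by
  obtain ⟨L, hL, hLt⟩ := exists_linearForm_eval_seqTensor (d := d) (k := s + 1) hsd
  refine ⟨L, ProjSpace.mem_vanishingIdeal_image hL fun x _ => ?_, ⟨1, hL⟩, ?_⟩
  · rw [recTensor, hLt, recSeq_of_lt _ (by lia)]
    simp [trunc_inr]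
  · have h1 : recSeq (trunc (s + 1) (fun _ => 1 : RecParam R → ℂ)) (s + 1) = 1 := by
      rw [recSeq_of_lt _ (by lia)]
      simp [trunc_inr]
    refine notMem_vanishingIdeal_chainSet (y := trunc (s + 1) fun _ => 1) ?_
      (k := s + 1) hsd (by rw [h1]; exact one_ne_zero) (by
        rw [recTensor, hLt, h1]
        exact one_ne_zero)
    ext v
    simp only [trunc]
    split_ifs <;> rfl

/-- The columns of the Hankel-like matrix whose determinant detects the coefficient of
position `R + 3 + i`. -/
def hankelShift (R i : ℕ) (l : Fin (i + 1)) : ℕ := if (l : ℕ) < i then R + 1 - l else R + 3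

/-- The Hankel-like matrix whose determinant detects the coefficient of position `R + 3 + i`. -/
def hankel (R i : ℕ) (t : ℕ → ℂ) : Matrix (Fin (i + 1)) (Fin (i + 1)) ℂ :=
  Matrix.of fun n l => t (n + hankelShift R i l)

theorem exists_eval_eq_det_hankel {d i : ℕ} (hd : R + 3 + i ≤ d) :
    ∃ F : MvPolynomial (Sym (Fin 2) d) ℂ, F.IsHomogeneous (i + 1) ∧
      ∀ t : ℕ → ℂ, MvPolynomial.eval (seqTensor d t) F = (hankel R i t).det := by
  have hle : ∀ n l : Fin (i + 1), n + hankelShift R i l ≤ d := by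
    intro n l
    unfold hankelShift
    split_ifs <;> lia
  choose L hL hLt using fun n l => exists_linearForm_eval_seqTensor (hle n l)
  refine ⟨(Matrix.of L).det, ?_, fun t => ?_⟩
  · simpa using MvPolynomial.isHomogeneous_det (Matrix.of L) hL
  · rw [RingHom.map_det]
    congr 1
    ext n l
    exact hLt n l t

/-- Only the coefficients of index `R + 1, …, R + 2 - i` survive the truncation, so the recurrence
writes the last column as a combination of the others. -/
theorem det_hankel_recSeq_trunc {i : ℕ} (hi : i ≤ R) (x : RecParam R → ℂ) :
    (hankel R i (recSeq (trunc (R + 2 + i) x))).det = 0 := by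
  set y := trunc (R + 2 + i) x with hy
  refine Matrix.exists_mulVec_eq_zero_iff.1
    ⟨Fin.snoc (α := fun _ => ℂ) (fun l : Fin i => recCoeff y ⟨R + 1 - l, by lia⟩) (-1), ?_, ?_⟩
  · intro h
    have := congrFun h (Fin.last i)
    simp at this
  · ext n
    simp only [Matrix.mulVec, dotProduct, Fin.sum_univ_castSucc, Fin.snoc_castSucc, Fin.snoc_last,
      hankel, Matrix.of_apply, hankelShift, Fin.val_castSucc, Fin.is_lt, if_true, Fin.val_last,
      lt_irrefl, if_false, Pi.zero_apply]
    rw [recSeq_add, ← Fintype.sum_of_injective (fun l : Fin i => (⟨R + 1 - l, by lia⟩ : Fin (R + 3)))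
      ?_ (fun l => recCoeff y ⟨R + 1 - l, by lia⟩ * recSeq y (n + (R + 1 - l))) _ ?_ fun l => rfl]
    · rw [mul_neg_one, ← sub_eq_add_neg, sub_eq_zero]
      exact Finset.sum_congr rfl fun l _ => mul_comm _ _
    · intro l l' h
      simp only [Fin.mk.injEq] at h
      lia
    · intro j hj
      rw [mul_eq_zero]
      left
      simp only [recCoeff]
      split_ifs with h
      · rw [hy, trunc_inl, if_neg]
        intro hle
        exact hj ⟨⟨R + 1 - j, by lia⟩, Fin.ext (by simp only; lia)⟩
      · rfl

/-- A parameter at which the determinant of the Hankel-like matrix does not vanish. -/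
def hankelPoint (R i : ℕ) : RecParam R → ℂ :=
  Sum.elim (fun l => if (l : ℕ) = R - i then 1 else 0)
    fun k => if (k : ℕ) = R ∨ (k : ℕ) = R + 1 then 1 else 0

theorem trunc_hankelPoint {i : ℕ} (hi : i ≤ R) :
    trunc (R + 3 + i) (hankelPoint R i) = hankelPoint R i := by
  ext v
  rcases v with l | k
  · simp only [trunc_inl, hankelPoint, Sum.elim_inl]
    split_ifs <;> first | rfl | lia
  · rw [trunc_inr, if_pos (by lia)]

theorem recSeq_hankelPoint_add {i : ℕ} (hi : i ≤ R) (n : ℕ) :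
    recSeq (hankelPoint R i) (n + (R + 3))
      = recSeq (hankelPoint R i) (n + if i < R then R + 1 - i else 0) := by
  have h : ∀ j : Fin (R + 3), recCoeff (hankelPoint R i) j
      = if j = ⟨if i < R then R + 1 - i else 0, by split_ifs <;> lia⟩ then 1 else 0 := by
    intro j
    simp only [recCoeff, hankelPoint, Sum.elim_inl, Fin.ext_iff]
    split_ifs <;> first | rfl | lia
  rw [recSeq_add]
  simp only [h, ite_mul, one_mul, zero_mul, Finset.sum_ite_eq', Finset.mem_univ, if_true]

theorem recSeq_hankelPoint_of_lt {i n : ℕ} (hn : n < R + 3) :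
    recSeq (hankelPoint R i) n = if n = R ∨ n = R + 1 then 1 else 0 := by
  rw [recSeq_of_lt _ hn]
  rfl

/-- The matrix is unitriangular. The diagonal entries before the last are `t (R + 1)`; the last one
reduces to `t (R + 1)` if `i < R`. If `i = R`, the active coefficient has index `0`, as index `1` is
skipped, and the entry is `t R`; hence the two nonzero initial values. -/
theorem det_hankel_hankelPoint {i : ℕ} (hi : i ≤ R) :
    (hankel R i (recSeq (hankelPoint R i))).det = 1 := by
  have hlast : ∀ n : ℕ, recSeq (hankelPoint R i) (n + (R + 3))
      = recSeq (hankelPoint R i) (n + if i < R then R + 1 - i else 0) :=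
    recSeq_hankelPoint_add hi
  rw [Matrix.det_of_isUpperTriangular]
  · refine Finset.prod_eq_one fun l _ => ?_
    simp only [hankel, Matrix.of_apply, hankelShift]
    split_ifs with h
    · rw [recSeq_hankelPoint_of_lt (by lia), if_pos (by lia)]
    · rw [hlast]
      split_ifs <;> rw [recSeq_hankelPoint_of_lt (by lia), if_pos (by lia)]
  · intro n l hln
    have hln : (l : ℕ) < n := hln
    simp only [hankel, Matrix.of_apply, hankelShift]
    rw [if_pos (by lia)]
    rcases Nat.lt_or_ge (l + 1 : ℕ) n with h | h
    -- One use of the recurrence brings the index below `R`, where the initial values vanish; the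
    -- first subdiagonal is `t (R + 2) = 0`.
    · rw [show (n : ℕ) + (R + 1 - l) = (n - l - 2) + (R + 3) by lia, hlast]
      split_ifs <;> rw [recSeq_hankelPoint_of_lt (by lia), if_neg (by lia)]
    · rw [recSeq_hankelPoint_of_lt (by lia), if_neg (by lia)]

theorem exists_separating_coeff {d i : ℕ} (hi : i ≤ R) (hd : R + 3 + i ≤ d) :
    ∃ F ∈ ProjSpace.vanishingIdeal (chainSet R d (R + 2 + i)), (∃ k : ℕ, F.IsHomogeneous k) ∧
      F ∉ ProjSpace.vanishingIdeal (chainSet R d (R + 3 + i)) := by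
  obtain ⟨F, hF, hFt⟩ := exists_eval_eq_det_hankel (R := R) hd
  refine ⟨F, ProjSpace.mem_vanishingIdeal_image hF fun x _ => ?_, ⟨_, hF⟩,
    notMem_vanishingIdeal_chainSet (trunc_hankelPoint hi) (k := R) (by lia) ?_ ?_⟩
  · rw [recTensor, hFt, det_hankel_recSeq_trunc hi]
  · rw [recSeq_hankelPoint_of_lt (by lia), if_pos (Or.inl rfl)]
    exact one_ne_zero
  · rw [recTensor, hFt, det_hankel_hankelPoint hi]
    exact one_ne_zero

/-! ### Irreducibility and dimension. -/

theorem WithBot.le_natCast_of_add_one_le {D : WithBot ℕ∞} {n : ℕ}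
    (h : D + 1 ≤ ((n + 1 : ℕ) : WithBot ℕ∞)) : D ≤ (n : WithBot ℕ∞) := by
  induction D with
  | bot => exact bot_le
  | coe D =>
    have h : D + 1 ≤ (n : ℕ∞) + 1 := by exact_mod_cast h
    exact_mod_cast (ENat.add_le_add_iff_right ENat.one_ne_top).1 h

theorem lemma3p3 (r d : ℕ) (hr : 3 ≤ r) (hd : 1 ≤ d) :
    IsIrreducible (fradecoVariety r 2 d) ∧
      topologicalKrullDim (fradecoVariety r 2 d) = ((min (2 * r - 3) d : ℕ) : WithBot ℕ∞) := by
  obtain ⟨R, rfl⟩ := Nat.exists_eq_add_of_le' hr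
  rw [fradecoVariety_eq_closure_image]
  have hirr : IsIrreducible
      (closure (ProjSpace.image (recTensor d : (RecParam R → ℂ) → SymTensor 2 d))) :=
    (ProjSpace.isIrreducible_image (isPolynomialFun_recTensor d) (recTensor_ne_zero d)).closure
  refine ⟨hirr, le_antisymm ?_ ?_⟩
  · have h1 := ProjSpace.topologicalKrullDim_closure_image_add_one_le
      (isPolynomialFun_recTensor (R := R) d) (recTensor_ne_zero d) (exists_recTensor_eq_smul d)
    have h2 := ProjSpace.topologicalKrullDim_add_one_le_card hirr
    have hc1 : Nat.card (RecParam R) = (2 * (R + 3) - 3) + 1 := by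
      simp only [RecParam, Nat.card_eq_fintype_card, Fintype.card_sum, Fintype.card_fin]
      lia
    have hc2 : Nat.card (Sym (Fin 2) d) = d + 1 := by
      rw [Nat.card_eq_fintype_card, Sym.card_sym_eq_choose, Fintype.card_fin,
        show 2 + d - 1 = d + 1 by lia, Nat.choose_succ_self_right]
    rw [hc1] at h1
    rw [hc2] at h2
    rcases min_choice (2 * (R + 3) - 3) d with h | h <;> rw [h]
    · exact WithBot.le_natCast_of_add_one_le h1
    · exact WithBot.le_natCast_of_add_one_le h2
  · refine ProjSpace.le_topologicalKrullDim isClosed_closure (chainSet R d)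
      (fun s _ => isIrreducible_chainSet R d s)
      (fun s _ => (chainSet_subset_image R d s).trans subset_closure)
      (fun s _ => chainSet_subset_succ R d s) fun s hs => ?_
    rcases Nat.lt_or_ge (R + 1) s with h | h
    · obtain ⟨i, rfl⟩ := Nat.exists_eq_add_of_le h
      have := exists_separating_coeff (R := R) (d := d) (i := i) (by lia) (by lia)
      rwa [show R + 3 + i = R + 1 + 1 + i + 1 by lia] at this
    · exact exists_separating_initial h (by lia)
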